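/- Let $E$ be a separable complex Hilbert space and let $\mathcal{B}(E)$ be the space of bounded linear operators on $E$. Let $H^2_E(\mathbb{D})$ be the $E$-valued Hardy space on the open unit disc $\mathbb{D}$, i.e. the Hilbert space of functions $f(z)=\sum_{n\ge 0} z^n a_n$ with $a_n\in E$ and $\|f\|^2=\sum_{n\ge 0}\|a_n\|^2<\infty$. Let $S_E$ be the shift on $H^2_E(\mathbb{D})$, $(S_Ef)(z)=zf(z)$, and let $P_E$ be the orthogonal projection of $H^2_E(\mathbb{D})$ onto the subspace of constant functions, identified with $E$. Let $H^\infty_{\mathcal{B}(E)}(\mathbb{D})$ be the space of bounded analytic functions $\Psi:\mathbb{D}\to\mathcal{B}(E)$; for such $\Psi$, $\Psi P_E$ denotes the operator $(\Psi P_E f)(z)=\Psi(z)\,(P_Ef)(z)$ on $H^2_E(\mathbb{D})$. A bounded operator $T$ on a Hilbert space is similar to a contraction if $\|V^{-1}TV\|\le 1$ for some bounded invertible operator $V$ on that space. Let $X\in\mathcal{B}(H^2_E(\mathbb{D}))$. Then the following are equivalent: 1. The operator $\begin{bmatrix} S_E & X\\ 0 & S_E^*\end{bmatrix}$ on the Hilbert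 space direct sum $H^2_E(\mathbb{D})\oplus H^2_E(\mathbb{D})$ is similar to a contraction. 2. There exist $A\in\mathcal{B}(H^2_E(\mathbb{D}))$ and $\Psi\in H^\infty_{\mathcal{B}(E)}(\mathbb{D})$ such that $A^*P_E=\Psi P_E$ and $X=A-S_E^*AS_E^*$. 3. There exist $A\in\mathcal{B}(H^2_E(\mathbb{D}))$ and $\Psi\in H^\infty_{\mathcal{B}(E)}(\mathbb{D})$ such that $AP_E=XP_E$, $A^*P_E=\Psi P_E$ and $XS_E=AS_E-S_E^*A$. -/

import Mathlib

open scoped ENNReal InnerProductSpace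

noncomputable section

/-! ### The vector-valued Hardy space on the open unit disc -/

/-- The open unit disc, as a type. -/
abbrev OpenDisc : Type := Metric.ball (0 : ℂ) 1

/-- The Hilbert space `ℓ²(ℕ, E)` of square-summable sequences in `E`. -/
abbrev CoeffSpace (E : Type*) [NormedAddCommGroup E] : Type _ := lp (fun _ : ℕ => E) 2

section Defs

variable {E : Type*} [NormedAddCommGroup E]

theorem CoeffSpace.summable_sq (a : CoeffSpace E) : Summable fun n => ‖a n‖ ^ 2 := by
  have h := (lp.memℓp a).summable (by norm_num)
  simpa using h

theorem CoeffSpace.norm_sq_eq (a : CoeffSpace E) : ‖a‖ ^ 2 = ∑' n, ‖a n‖ ^ 2 := by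
  have h := lp.norm_rpow_eq_tsum (p := 2) (by norm_num) a
  simpa using h

variable [InnerProductSpace ℂ E] [CompleteSpace E]

/-- A power series with square-summable coefficients converges on the open unit disc. -/
theorem CoeffSpace.summable_powerSeries (a : CoeffSpace E) (z : OpenDisc) :
    Summable fun n => (z : ℂ) ^ n • a n := by
  have hz : ‖(z : ℂ)‖ < 1 := mem_ball_zero_iff.1 z.2
  refine Summable.of_norm_bounded
    (g := fun n => ‖a‖ * ‖(z : ℂ)‖ ^ n)
    ((summable_geometric_of_lt_one (norm_nonneg _) hz).mul_left _) fun n => ?_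
  rw [norm_smul, norm_pow, mul_comm]
  exact mul_le_mul_of_nonneg_right (lp.norm_apply_le_norm (by norm_num) a n) (by positivity)

variable (E)

/-- The map sending `(aₙ) ∈ ℓ²(ℕ, E)` to the function `z ↦ ∑ₙ zⁿ aₙ` on the open unit disc. -/
def powerSeriesMap : CoeffSpace E →ₗ[ℂ] (OpenDisc → E) where
  toFun a z := ∑' n, (z : ℂ) ^ n • a n
  map_add' a b := by
    funext z
    simp only [lp.coeFn_add, Pi.add_apply, smul_add]
    exact (a.summable_powerSeries z).tsum_add (b.summable_powerSeries z)
  map_smul' c a := by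
    funext z
    simp only [lp.coeFn_smul, Pi.smul_apply, RingHom.id_apply]
    rw [← (a.summable_powerSeries z).tsum_const_smul c]
    exact tsum_congr fun n => smul_comm _ _ _

theorem powerSeriesMap_injective : Function.Injective (powerSeriesMap E) := by
  rw [← LinearMap.ker_eq_bot, LinearMap.ker_eq_bot']
  intro a ha
  let p : FormalMultilinearSeries ℂ ℂ E :=
    fun n => ContinuousMultilinearMap.mkPiRing ℂ (Fin n) (a n)
  have hc : ∀ n, p.coeff n = a n := fun n => by
    simp [p, FormalMultilinearSeries.coeff, ContinuousMultilinearMap.mkPiRing_apply]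
  have hp : HasFPowerSeriesAt (0 : ℂ → E) p 0 := by
    rw [hasFPowerSeriesAt_iff]
    filter_upwards [Metric.ball_mem_nhds (0 : ℂ) one_pos] with z hz
    simp only [hc]
    have h1 := (a.summable_powerSeries ⟨z, hz⟩).hasSum
    have h2 : ∑' n, z ^ n • a n = 0 := congrFun ha ⟨z, hz⟩
    simpa [h2] using h1
  have h0 := hp.eq_zero
  ext n
  rw [← hc n, h0]
  simp [FormalMultilinearSeries.coeff]

/-- The Hardy space `H²_E(𝔻)`: the `E`-valued functions on the open unit disc of the form
`f(z) = ∑ₙ zⁿ aₙ` with `∑ₙ ‖aₙ‖² < ∞`. -/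
def HardySpace : Type _ := LinearMap.range (powerSeriesMap E)

namespace HardySpace

instance : AddCommGroup (HardySpace E) :=
  inferInstanceAs (AddCommGroup (LinearMap.range (powerSeriesMap E)))

instance : Module ℂ (HardySpace E) :=
  inferInstanceAs (Module ℂ (LinearMap.range (powerSeriesMap E)))

/-- Elements of the Hardy space are functions on the disc. -/
instance : FunLike (HardySpace E) OpenDisc E where
  coe f := f.1
  coe_injective _ _ h := Subtype.ext h

/-- The Taylor coefficients of a function in the Hardy space. -/
def coeffs : HardySpace E ≃ₗ[ℂ] CoeffSpace E :=
  (LinearEquiv.ofInjective (powerSeriesMap E) (powerSeriesMap_injective E)).symm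

/-- The Hilbert space structure of `H²_E(𝔻)`: `⟪f, g⟫ = ∑ₙ ⟪aₙ, bₙ⟫` for `f = ∑ₙ zⁿ aₙ` and
`g = ∑ₙ zⁿ bₙ`, so that `‖f‖² = ∑ₙ ‖aₙ‖²`. -/
instance : NormedAddCommGroup (HardySpace E) :=
  NormedAddCommGroup.induced (HardySpace E) (CoeffSpace E) (coeffs E) (coeffs E).injective

instance : InnerProductSpace ℂ (HardySpace E) where
  norm_smul_le c f := by
    change ‖coeffs E (c • f)‖ ≤ ‖c‖ * ‖coeffs E f‖
    rw [map_smul, norm_smul]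
  inner f g := ⟪coeffs E f, coeffs E g⟫_ℂ
  norm_sq_eq_re_inner f := InnerProductSpace.norm_sq_eq_re_inner (𝕜 := ℂ) (coeffs E f)
  conj_inner_symm f g := inner_conj_symm _ _
  add_left f g h := by rw [map_add, inner_add_left]
  smul_left f g c := by rw [map_smul, inner_smul_left]

variable {E}

theorem inner_def (f g : HardySpace E) :
    ⟪f, g⟫_ℂ = ∑' n, ⟪coeffs E f n, coeffs E g n⟫_ℂ := rfl

theorem norm_def (f : HardySpace E) : ‖f‖ = ‖coeffs E f‖ := rfl

theorem norm_sq_eq (f : HardySpace E) : ‖f‖ ^ 2 = ∑' n, ‖coeffs E f n‖ ^ 2 :=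
  CoeffSpace.norm_sq_eq (coeffs E f)

theorem hasSum_apply (f : HardySpace E) (z : OpenDisc) :
    HasSum (fun n => (z : ℂ) ^ n • coeffs E f n) (f z) := by
  obtain ⟨a, rfl⟩ := (coeffs E).symm.surjective f
  rw [LinearEquiv.apply_symm_apply]
  exact (a.summable_powerSeries z).hasSum

@[ext] theorem ext {f g : HardySpace E} (h : ∀ z, f z = g z) : f = g := DFunLike.ext f g h

@[simp] theorem add_apply (f g : HardySpace E) (z : OpenDisc) : (f + g) z = f z + g z := rfl

@[simp] theorem smul_apply (c : ℂ) (f : HardySpace E) (z : OpenDisc) : (c • f) z = c • f z := rfl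

@[simp] theorem zero_apply (z : OpenDisc) : (0 : HardySpace E) z = 0 := rfl

/-- The function `φ`, with Taylor coefficients `a ∈ ℓ²(ℕ, E)`, as an element of the Hardy space. -/
def ofHasSum (φ : OpenDisc → E) (a : CoeffSpace E)
    (h : ∀ z : OpenDisc, HasSum (fun n => (z : ℂ) ^ n • a n) (φ z)) : HardySpace E :=
  ⟨φ, a, funext fun z => (h z).tsum_eq⟩

@[simp] theorem ofHasSum_apply (φ : OpenDisc → E) (a : CoeffSpace E)
    (h : ∀ z : OpenDisc, HasSum (fun n => (z : ℂ) ^ n • a n) (φ z)) (z : OpenDisc) :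
    ofHasSum φ a h z = φ z := rfl

theorem coeffs_ofHasSum (φ : OpenDisc → E) (a : CoeffSpace E)
    (h : ∀ z : OpenDisc, HasSum (fun n => (z : ℂ) ^ n • a n) (φ z)) :
    coeffs E (ofHasSum φ a h) = a := by
  have e : ofHasSum φ a h = (coeffs E).symm a :=
    Subtype.ext (funext fun z => (h z).tsum_eq.symm)
  rw [e, LinearEquiv.apply_symm_apply]

instance : CompleteSpace (HardySpace E) := by
  let e : HardySpace E ≃ₗᵢ[ℂ] CoeffSpace E := ⟨coeffs E, fun _ => rfl⟩
  exact e.toIsometryEquiv.completeSpace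

/-! ### The shift -/

/-- The sequence `(0, a₀, a₁, …)`. -/
def shiftCoeffs (a : CoeffSpace E) : CoeffSpace E :=
  ⟨fun n => Nat.casesOn n 0 fun k => a k, by
    refine memℓp_gen ((summable_nat_add_iff 1).1 ?_)
    simpa using a.summable_sq⟩

theorem hasSum_shift (f : HardySpace E) (z : OpenDisc) :
    HasSum (fun n => (z : ℂ) ^ n • shiftCoeffs (coeffs E f) n) ((z : ℂ) • f z) := by
  rw [← hasSum_nat_add_iff' 1]
  have h := (f.hasSum_apply z).const_smul (z : ℂ)
  simpa [shiftCoeffs, pow_succ', mul_smul] using h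

variable (E)

/-- The shift `S_E` on `H²_E(𝔻)`: multiplication by the coordinate, `(S_E f)(z) = z f(z)`. -/
def shift : HardySpace E →L[ℂ] HardySpace E :=
  LinearMap.mkContinuous
    { toFun := fun f => ofHasSum (fun z => (z : ℂ) • f z) _ f.hasSum_shift
      map_add' := fun f g => HardySpace.ext fun z => smul_add (z : ℂ) (f z) (g z)
      map_smul' := fun c f => HardySpace.ext fun z => smul_comm (z : ℂ) c (f z) }
    1 fun f => by
      change ‖ofHasSum (fun z => (z : ℂ) • f z) _ f.hasSum_shift‖ ≤ 1 * ‖f‖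
      rw [one_mul, ← sq_le_sq₀ (norm_nonneg _) (norm_nonneg _), norm_sq_eq, norm_sq_eq,
        coeffs_ofHasSum, (shiftCoeffs (coeffs E f)).summable_sq.tsum_eq_zero_add]
      simp [shiftCoeffs]

theorem shift_apply (f : HardySpace E) (z : OpenDisc) : shift E f z = (z : ℂ) • f z := rfl

/-! ### The constants and the projection onto them -/

/-- `E`, regarded as the subspace of constant functions of `H²_E(𝔻)`. -/
def constants : Submodule ℂ (HardySpace E) where
  carrier := {f | ∃ e : E, ∀ z, f z = e}
  add_mem' := by
    rintro f g ⟨e, he⟩ ⟨e', he'⟩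
    exact ⟨e + e', fun z => by rw [add_apply, he, he']⟩
  zero_mem' := ⟨0, fun _ => rfl⟩
  smul_mem' := by
    rintro c f ⟨e, he⟩
    exact ⟨c • e, fun z => by rw [smul_apply, he]⟩

variable {E}

theorem exists_const (e : E) :
    ∃ f : HardySpace E, (∀ z, f z = e) ∧ coeffs E f = lp.single 2 0 e := by
  have h : ∀ z : OpenDisc,
      HasSum (fun n => (z : ℂ) ^ n • (lp.single 2 0 e : CoeffSpace E) n) e := fun z => by
    have := hasSum_single (f := fun n => (z : ℂ) ^ n • (lp.single 2 0 e : CoeffSpace E) n) 0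
      fun n hn => by simp [hn]
    simpa using this
  exact ⟨ofHasSum (fun _ => e) _ h, fun _ => rfl, coeffs_ofHasSum _ _ h⟩

instance : (constants E).HasOrthogonalProjection where
  exists_orthogonal f := by
    obtain ⟨g, hg, hg'⟩ := exists_const (coeffs E f 0)
    refine ⟨g, ⟨_, hg⟩, fun u hu => ?_⟩
    obtain ⟨e, he⟩ := hu
    obtain ⟨k, hk, hk'⟩ := exists_const e
    obtain rfl : u = k := HardySpace.ext fun z => by rw [he, hk]
    change ⟪coeffs E u, coeffs E (f - g)⟫_ℂ = 0
    rw [hk', lp.inner_single_left, map_sub, hg']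
    simp

variable (E)

/-- `P_E`, the orthogonal projection of `H²_E(𝔻)` onto the constants. -/
def projConst : HardySpace E →L[ℂ] HardySpace E := (constants E).starProjection

end HardySpace

variable {E}

/-- `Ψ` belongs to `H^∞_{B(E)}(𝔻)`: it is a bounded analytic `B(E)`-valued function on the open
unit disc (its values outside the disc are irrelevant). -/
def IsBoundedAnalytic (Ψ : ℂ → E →L[ℂ] E) : Prop :=
  AnalyticOnNhd ℂ Ψ (Metric.ball 0 1) ∧ ∃ C : ℝ, ∀ z ∈ Metric.ball (0 : ℂ) 1, ‖Ψ z‖ ≤ C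

end Defs

/-! ### Block operators and similarity to a contraction -/

section Operators

variable {H : Type*} [NormedAddCommGroup H] [InnerProductSpace ℂ H]

/-- The block operator `[[Y, X], [0, Z]]` on the Hilbert space direct sum `H ⊕ H`. -/
def upperBlock (Y X Z : H →L[ℂ] H) : WithLp 2 (H × H) →L[ℂ] WithLp 2 (H × H) :=
  ((WithLp.prodContinuousLinearEquiv 2 ℂ H H).symm : (H × H) →L[ℂ] WithLp 2 (H × H)) ∘L
    ((Y ∘L WithLp.fstL 2 ℂ H H + X ∘L WithLp.sndL 2 ℂ H H).prod (Z ∘L WithLp.sndL 2 ℂ H H))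

theorem upperBlock_apply (Y X Z : H →L[ℂ] H) (f g : H) :
    upperBlock Y X Z (WithLp.toLp 2 (f, g)) = WithLp.toLp 2 (Y f + X g, Z g) := rfl

/-- `T` is similar to a contraction: `‖V⁻¹ T V‖ ≤ 1` for some invertible bounded operator `V`. -/
def SimilarToContraction (T : H →L[ℂ] H) : Prop :=
  ∃ V : (H →L[ℂ] H)ˣ, ‖(↑V⁻¹ : H →L[ℂ] H) ∘L T ∘L (V : H →L[ℂ] H)‖ ≤ 1

end Operators

end

noncomputable section

/-! ### Shift, backward shift, constants and kernels in Taylor coefficients -/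

namespace HardySpace

variable {E : Type*} [NormedAddCommGroup E] [InnerProductSpace ℂ E] [CompleteSpace E]

/-! Write S for the shift, P for `projConst`, T for the block operator. If X = A - S*AS* and Q =
S*A, then A = PA + SS*A gives X = SQ - QS* + PA. The commutator part SQ - QS* is removed by the
similarity [[1, Q], [0, 1]], so the question is about the corner PA alone
(`eq_shift_mul_sub_mul_adjoint_add`).

From a multiplier to a contraction: the condition on Ψ says PA = PB, where B is the adjoint of
multiplication by Ψ and so commutes with S*. Since S is an isometry with range orthogonal to the
constants, renorming the second summand by ‖g‖² + ‖Bg‖² makes the reduced block a contraction: the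
new term ‖PBg‖² is paid for by ‖Bg‖² = ‖PBg‖² + ‖S*Bg‖² (`similarToContraction_of_multiplier`).

Conversely, only power boundedness of T is used. The corners of its powers bound the partial sums of
∑ S*ʲXS*ʲ, which converge strongly to some A because S*ⁿ → 0 strongly (`exists_stein_solution`). The
powers with corner PA are then bounded too, and by orthogonality this reads ∑ₖ ‖PAS*ᵏg‖² ≤ C²‖g‖²
(`norm_sq_cornerPow_shift`). Kernel functions are eigenvectors of S*, so testing on them bounds PA
on kernels, which by duality bounds the values of A*e on the disc; this is the symbol Ψ
(`exists_symbol`).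

The two forms of the equation for A agree because H² is the sum of the constants and the range of S.
-/

theorem ext_coeffs {f g : HardySpace E} (h : ∀ n, coeffs E f n = coeffs E g n) : f = g :=
  (coeffs E).injective (lp.ext (funext h))

@[simp] theorem coeffs_add_apply (f g : HardySpace E) (n : ℕ) :
    coeffs E (f + g) n = coeffs E f n + coeffs E g n := by
  rw [map_add]; rfl

@[simp] theorem coeffs_sub_apply (f g : HardySpace E) (n : ℕ) :
    coeffs E (f - g) n = coeffs E f n - coeffs E g n := by
  rw [map_sub]; rfl

@[simp] theorem coeffs_smul_apply (c : ℂ) (f : HardySpace E) (n : ℕ) :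
    coeffs E (c • f) n = c • coeffs E f n := by
  rw [map_smul]; rfl

theorem norm_coeffs_le (f : HardySpace E) (n : ℕ) : ‖coeffs E f n‖ ≤ ‖f‖ :=
  lp.norm_apply_le_norm (by norm_num) (coeffs E f) n

@[simp] theorem coeffs_shift_zero (f : HardySpace E) : coeffs E (shift E f) 0 = 0 := by
  change coeffs E (ofHasSum (fun z => (z : ℂ) • f z) _ f.hasSum_shift) 0 = 0
  rw [coeffs_ofHasSum]; rfl

@[simp] theorem coeffs_shift_succ (f : HardySpace E) (n : ℕ) :
    coeffs E (shift E f) (n + 1) = coeffs E f n := by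
  change coeffs E (ofHasSum (fun z => (z : ℂ) • f z) _ f.hasSum_shift) (n + 1) = _
  rw [coeffs_ofHasSum]; rfl

/-- The monomial `zⁿ x`. -/
def monomial (n : ℕ) (x : E) : HardySpace E := (coeffs E).symm (lp.single 2 n x)

@[simp] theorem coeffs_monomial (n : ℕ) (x : E) :
    coeffs E (monomial n x) = lp.single 2 n x := LinearEquiv.apply_symm_apply _ _

theorem norm_monomial (n : ℕ) (x : E) : ‖monomial n x‖ = ‖x‖ := by
  rw [norm_def, coeffs_monomial, lp.norm_single (by norm_num)]

theorem inner_monomial_left (n : ℕ) (x : E) (f : HardySpace E) :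
    ⟪monomial n x, f⟫_ℂ = ⟪x, coeffs E f n⟫_ℂ := by
  change ⟪coeffs E (monomial n x), coeffs E f⟫_ℂ = _
  rw [coeffs_monomial, lp.inner_single_left]

theorem shift_monomial (n : ℕ) (x : E) : shift E (monomial n x) = monomial (n + 1) x := by
  refine ext_coeffs fun k => ?_
  cases k with
  | zero => simp
  | succ k => simp [lp.single_apply, Pi.single_apply]

theorem monomial_zero_apply (x : E) (z : OpenDisc) : monomial 0 x z = x := by
  obtain ⟨f, hf, hf'⟩ := exists_const x
  have : monomial 0 x = f := (coeffs E).injective (by rw [coeffs_monomial, hf'])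
  rw [this, hf]

@[simp] theorem coeffs_adjoint_shift (f : HardySpace E) (n : ℕ) :
    coeffs E (ContinuousLinearMap.adjoint (shift E) f) n = coeffs E f (n + 1) := by
  refine ext_inner_left ℂ fun x => ?_
  rw [← inner_monomial_left, ContinuousLinearMap.adjoint_inner_right, shift_monomial,
    inner_monomial_left]

theorem coeffs_adjoint_shift_pow (n k : ℕ) (f : HardySpace E) :
    coeffs E ((ContinuousLinearMap.adjoint (shift E) ^ n) f) k = coeffs E f (k + n) := by
  induction n generalizing k with
  | zero => simp
  | succ n ih =>
    rw [pow_succ', mul_apply_eq_comp, coeffs_adjoint_shift, ih]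
    rw [add_right_comm, add_assoc]

@[simp] theorem adjoint_shift_shift (f : HardySpace E) :
    ContinuousLinearMap.adjoint (shift E) (shift E f) = f :=
  ext_coeffs fun n => by simp

theorem norm_shift_apply (f : HardySpace E) : ‖shift E f‖ = ‖f‖ := by
  rw [← sq_eq_sq₀ (norm_nonneg _) (norm_nonneg _), norm_sq_eq, norm_sq_eq,
    (coeffs E (shift E f)).summable_sq.tsum_eq_zero_add]
  simp

theorem projConst_apply_eq (f : HardySpace E) : projConst E f = monomial 0 (coeffs E f 0) := by
  refine Submodule.eq_starProjection_of_mem_of_inner_eq_zero ⟨_, monomial_zero_apply _⟩ ?_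
  rintro g ⟨e, he⟩
  have : g = monomial 0 e := ext fun z => by rw [he, monomial_zero_apply]
  rw [this, ← inner_conj_symm, inner_monomial_left]
  simp

@[simp] theorem coeffs_projConst_zero (f : HardySpace E) :
    coeffs E (projConst E f) 0 = coeffs E f 0 := by
  simp [projConst_apply_eq]

theorem projConst_add_shift_adjoint_shift (f : HardySpace E) :
    projConst E f + shift E (ContinuousLinearMap.adjoint (shift E) f) = f := by
  refine ext_coeffs fun n => ?_
  cases n with
  | zero => simp
  | succ n => simp [projConst_apply_eq]

@[simp] theorem adjoint_shift_projConst (f : HardySpace E) :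
    ContinuousLinearMap.adjoint (shift E) (projConst E f) = 0 :=
  ext_coeffs fun n => by simp [projConst_apply_eq]

@[simp] theorem projConst_shift (f : HardySpace E) : projConst E (shift E f) = 0 :=
  ext_coeffs fun n => by simp [projConst_apply_eq]

theorem norm_projConst_apply (f : HardySpace E) : ‖projConst E f‖ = ‖coeffs E f 0‖ := by
  rw [projConst_apply_eq, norm_monomial]

theorem inner_shift_projConst (f g : HardySpace E) : ⟪shift E f, projConst E g⟫_ℂ = 0 := by
  rw [← ContinuousLinearMap.adjoint_inner_right, adjoint_shift_projConst, inner_zero_right]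

theorem norm_sq_shift_add_projConst (f g : HardySpace E) :
    ‖shift E f + projConst E g‖ ^ 2 = ‖f‖ ^ 2 + ‖projConst E g‖ ^ 2 := by
  have := norm_add_sq_eq_norm_sq_add_norm_sq_of_inner_eq_zero _ _ (inner_shift_projConst f g)
  rw [norm_shift_apply] at this
  simpa [sq] using this

/-- Pythagoras for f = Pf + S(S*f), with S isometric. -/
theorem norm_sq_projConst_add_norm_sq_adjoint_shift (f : HardySpace E) :
    ‖projConst E f‖ ^ 2 + ‖ContinuousLinearMap.adjoint (shift E) f‖ ^ 2 = ‖f‖ ^ 2 := by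
  conv_rhs => rw [← projConst_add_shift_adjoint_shift f, add_comm, norm_sq_shift_add_projConst]
  ring

theorem adjoint_projConst : ContinuousLinearMap.adjoint (projConst E) = projConst E :=
  (isSelfAdjoint_starProjection (constants E)).adjoint_eq

theorem norm_adjoint_shift_apply_le (f : HardySpace E) :
    ‖ContinuousLinearMap.adjoint (shift E) f‖ ≤ ‖f‖ := by
  rw [← sq_le_sq₀ (norm_nonneg _) (norm_nonneg _)]
  nlinarith [norm_sq_projConst_add_norm_sq_adjoint_shift f, sq_nonneg ‖projConst E f‖]

theorem norm_shift_pow_apply (n : ℕ) (f : HardySpace E) : ‖(shift E ^ n) f‖ = ‖f‖ := by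
  induction n with
  | zero => simp
  | succ n ih => rw [pow_succ', mul_apply_eq_comp, norm_shift_apply, ih]

theorem norm_adjoint_shift_pow_apply_le (n : ℕ) (f : HardySpace E) :
    ‖(ContinuousLinearMap.adjoint (shift E) ^ n) f‖ ≤ ‖f‖ := by
  induction n with
  | zero => simp
  | succ n ih =>
    rw [pow_succ', mul_apply_eq_comp]
    exact (norm_adjoint_shift_apply_le _).trans ih

/-- The squared norm of S*ⁿf is the n-th tail of the convergent series ∑ ‖aₖ‖². -/
theorem tendsto_adjoint_shift_pow (f : HardySpace E) :
    Filter.Tendsto (fun n => ‖(ContinuousLinearMap.adjoint (shift E) ^ n) f‖)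
      Filter.atTop (nhds 0) := by
  have h := tendsto_sum_nat_add fun n => ‖coeffs E f n‖ ^ 2
  have h2 : Filter.Tendsto (fun n => √(‖(ContinuousLinearMap.adjoint (shift E) ^ n) f‖ ^ 2))
      Filter.atTop (nhds (√0)) := by
    refine (Real.continuous_sqrt.tendsto 0).comp ?_
    simpa only [norm_sq_eq, coeffs_adjoint_shift_pow] using h
  simpa using h2

/-- The kernel function `w ↦ ∑ₙ (z̄ w)ⁿ x`, which represents `f ↦ ⟪x, f z⟫`. -/
def kernel (z : OpenDisc) (x : E) : HardySpace E :=
  (coeffs E).symm ⟨fun n => (starRingEnd ℂ (z : ℂ)) ^ n • x, by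
    have hz : ‖(z : ℂ)‖ < 1 := mem_ball_zero_iff.1 z.2
    refine memℓp_gen ?_
    have h := (summable_geometric_of_lt_one (by positivity)
      (pow_lt_one₀ (norm_nonneg (z : ℂ)) hz two_ne_zero)).mul_right (‖x‖ ^ 2)
    refine h.congr fun n => ?_
    simp [norm_smul, mul_pow]
    left; ring⟩

theorem coeffs_kernel (z : OpenDisc) (x : E) (n : ℕ) :
    coeffs E (kernel z x) n = (starRingEnd ℂ (z : ℂ)) ^ n • x := by
  rw [kernel, LinearEquiv.apply_symm_apply]

theorem adjoint_shift_kernel (z : OpenDisc) (x : E) :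
    ContinuousLinearMap.adjoint (shift E) (kernel z x) = (starRingEnd ℂ (z : ℂ)) • kernel z x :=
  ext_coeffs fun n => by simp [coeffs_kernel, pow_succ', mul_smul]

theorem adjoint_shift_pow_kernel (n : ℕ) (z : OpenDisc) (x : E) :
    (ContinuousLinearMap.adjoint (shift E) ^ n) (kernel z x) =
      (starRingEnd ℂ (z : ℂ)) ^ n • kernel z x := by
  induction n with
  | zero => simp
  | succ n ih =>
    rw [pow_succ', mul_apply_eq_comp, ih, map_smul, adjoint_shift_kernel, smul_smul,
      pow_succ]

theorem inner_kernel_left (z : OpenDisc) (x : E) (f : HardySpace E) :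
    ⟪kernel z x, f⟫_ℂ = ⟪x, f z⟫_ℂ := by
  refine (inner_def _ _).trans (Eq.trans (tsum_congr fun n => ?_)
    ((hasSum_apply f z).mapL (innerSL ℂ x)).tsum_eq)
  simp [coeffs_kernel, mul_comm]

theorem norm_sq_kernel (z : OpenDisc) (x : E) :
    ‖kernel z x‖ ^ 2 = (∑' n : ℕ, (‖(z : ℂ)‖ ^ 2) ^ n) * ‖x‖ ^ 2 := by
  rw [norm_sq_eq, ← tsum_mul_right]
  refine tsum_congr fun n => ?_
  rw [coeffs_kernel, norm_smul, norm_pow, RCLike.norm_conj]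
  ring

end HardySpace

/-! ### Vector-valued power series on the disc -/

section PowerSeries

variable {F : Type*} [NormedAddCommGroup F] [NormedSpace ℂ F]

theorem summable_pow_smul_of_bounded [CompleteSpace F] {c : ℕ → F} {C : ℝ} (hc : ∀ n, ‖c n‖ ≤ C)
    {z : ℂ} (hz : ‖z‖ < 1) : Summable fun n => z ^ n • c n := by
  refine Summable.of_norm_bounded
    ((summable_geometric_of_lt_one (norm_nonneg _) hz).mul_right C) fun n => ?_
  rw [norm_smul, norm_pow]
  exact mul_le_mul_of_nonneg_left (hc n) (by positivity)

/-- A power series with bounded coefficients is analytic on the unit disc. -/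
theorem analyticOnNhd_tsum_pow_smul [CompleteSpace F] {c : ℕ → F} {C : ℝ} (hc : ∀ n, ‖c n‖ ≤ C) :
    AnalyticOnNhd ℂ (fun z : ℂ => ∑' n, z ^ n • c n) (Metric.ball 0 1) := by
  let p : FormalMultilinearSeries ℂ ℂ F :=
    fun n => ContinuousMultilinearMap.mkPiRing ℂ (Fin n) (c n)
  have hr : 1 ≤ p.radius := by
    have := p.le_radius_of_bound (r := 1) C fun n => by simpa [p] using hc n
    simpa using this
  have hp := (p.hasFPowerSeriesOnBall (zero_lt_one.trans_le hr)).analyticOnNhd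
  have hs : p.sum = fun z : ℂ => ∑' n, z ^ n • c n := by
    funext z
    simp [FormalMultilinearSeries.sum, p, ContinuousMultilinearMap.mkPiRing_apply]
  rw [hs] at hp
  refine hp.mono ?_
  intro z hz
  refine Metric.eball_subset_eball hr ?_
  have := Metric.eball_ofReal (x := (0 : ℂ)) (ε := 1)
  rw [ENNReal.ofReal_one] at this
  rwa [this]

/-- A power series which converges on the unit disc converges absolutely there. -/
theorem summable_pow_mul_norm {c : ℕ → F}
    (h : ∀ z : ℂ, ‖z‖ < 1 → Summable fun n => z ^ n • c n) {r : ℝ} (hr0 : 0 ≤ r) (hr : r < 1) :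
    Summable fun n => r ^ n * ‖c n‖ := by
  -- At an intermediate radius ρ the terms are bounded; passing from ρ to r gains the geometric
  -- factor (r/ρ)ⁿ.
  obtain ⟨ρ, hrρ, hρ⟩ := exists_between hr
  have hρ0 : 0 < ρ := hr0.trans_lt hrρ
  have hs := h ρ (by rwa [Complex.norm_real, Real.norm_of_nonneg hρ0.le])
  obtain ⟨C, hC⟩ := hs.tendsto_atTop_zero.norm.bddAbove_range
  have hC' : ∀ n, ρ ^ n * ‖c n‖ ≤ C := fun n => by
    have := hC ⟨n, rfl⟩
    simpa [norm_smul, abs_of_pos hρ0] using this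
  refine Summable.of_nonneg_of_le (fun n => by positivity) (fun n => ?_)
    ((summable_geometric_of_lt_one (div_nonneg hr0 hρ0.le) ((div_lt_one hρ0).2 hrρ)).mul_right C)
  calc r ^ n * ‖c n‖ = (r / ρ) ^ n * (ρ ^ n * ‖c n‖) := by
        rw [div_pow]; field_simp
    _ ≤ _ := mul_le_mul_of_nonneg_left (hC' n) (by positivity)

end PowerSeries

/-! ### Parseval's identity on circles -/

section Parseval

variable {E : Type*} [NormedAddCommGroup E] [InnerProductSpace ℂ E]

theorem integral_circleMap_conj_pow_mul_pow (r : ℝ) (m n : ℕ) :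
    ∫ θ in (0 : ℝ)..2 * Real.pi,
      (starRingEnd ℂ (circleMap 0 r θ)) ^ m * (circleMap 0 r θ) ^ n =
        if n = m then ((2 * Real.pi * (r ^ m) ^ 2 : ℝ) : ℂ) else 0 := by
  have key : ∀ θ : ℝ, (starRingEnd ℂ (circleMap 0 r θ)) ^ m * (circleMap 0 r θ) ^ n =
      (r : ℂ) ^ (m + n) * Complex.exp ((((n : ℤ) - (m : ℤ) : ℤ) * Complex.I) * θ) := fun θ => by
    simp only [circleMap_zero, map_mul, Complex.conj_ofReal, ← Complex.exp_conj, Complex.conj_I,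
      mul_pow, ← Complex.exp_nat_mul]
    rw [mul_mul_mul_comm, ← pow_add, ← Complex.exp_add]
    congr 2
    push_cast
    ring
  simp only [key]
  rw [intervalIntegral.integral_const_mul]
  split_ifs with h
  · subst h
    simp
    ring
  · have h0 : ((((n : ℤ) - (m : ℤ) : ℤ) : ℂ) * Complex.I) ≠ 0 := by
      refine mul_ne_zero ?_ Complex.I_ne_zero
      exact Int.cast_ne_zero.2 (by omega)
    rw [integral_exp_mul_complex h0]
    have : Complex.exp ((((n : ℤ) - (m : ℤ) : ℤ) * Complex.I) * ((2 * Real.pi : ℝ) : ℂ)) = 1 := by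
      rw [← Complex.exp_int_mul_two_pi_mul_I ((n : ℤ) - (m : ℤ))]
      congr 1
      push_cast
      ring
    rw [this]
    simp

/-- Integrating `∑ₙ zⁿ cₙ` termwise over a circle, after applying `⟪w(z), ·⟫`. -/
theorem hasSum_integral_inner_circleMap {c : ℕ → E} {h : ℂ → E} {r : ℝ} (hr : 0 ≤ r)
    (hc : Summable fun n => r ^ n * ‖c n‖)
    (hh : ∀ z : ℂ, ‖z‖ = r → HasSum (fun n => z ^ n • c n) (h z))
    {w : ℝ → E} (hw : Continuous w) {B : ℝ} (hB : ∀ θ, ‖w θ‖ ≤ B) :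
    HasSum (fun n => ∫ θ in (0 : ℝ)..2 * Real.pi, ⟪w θ, (circleMap 0 r θ) ^ n • c n⟫_ℂ)
      (∫ θ in (0 : ℝ)..2 * Real.pi, ⟪w θ, h (circleMap 0 r θ)⟫_ℂ) := by
  have hn : ∀ θ, ‖circleMap 0 r θ‖ = r := fun θ => by simp [abs_of_nonneg hr]
  refine intervalIntegral.hasSum_integral_of_dominated_convergence
    (fun n _ => B * (r ^ n * ‖c n‖)) (fun n => ?_) (fun n => ?_) ?_ ?_ ?_
  · refine Continuous.aestronglyMeasurable ?_
    have := continuous_circleMap 0 r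
    fun_prop
  · refine Filter.Eventually.of_forall fun θ _ => ?_
    refine (norm_inner_le_norm _ _).trans ?_
    rw [norm_smul, norm_pow, hn]
    exact mul_le_mul_of_nonneg_right (hB θ) (by positivity)
  · exact Filter.Eventually.of_forall fun θ _ => hc.mul_left B
  · exact intervalIntegrable_const
  · exact Filter.Eventually.of_forall fun θ _ =>
      (hh _ (hn θ)).mapL (innerSL ℂ (w θ))

/-- Parseval's identity for a vector-valued power series on a circle. -/
theorem hasSum_norm_sq_of_hasSum_pow_smul [CompleteSpace E] {c : ℕ → E} {h : ℂ → E}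
    (hh : ∀ z : ℂ, ‖z‖ < 1 → HasSum (fun n => z ^ n • c n) (h z))
    (hcont : ContinuousOn h (Metric.ball 0 1)) {r : ℝ} (hr0 : 0 ≤ r) (hr : r < 1) :
    HasSum (fun n => 2 * Real.pi * ((r ^ n) ^ 2 * ‖c n‖ ^ 2))
      (∫ θ in (0 : ℝ)..2 * Real.pi, ‖h (circleMap 0 r θ)‖ ^ 2) := by
  have hn : ∀ θ, ‖circleMap 0 r θ‖ = r := fun θ => by simp [abs_of_nonneg hr0]
  have hc := summable_pow_mul_norm (fun z hz => (hh z hz).summable) hr0 hr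
  have hh' : ∀ z : ℂ, ‖z‖ = r → HasSum (fun n => z ^ n • c n) (h z) :=
    fun z hz => hh z (hz.trans_lt hr)
  have hwc : Continuous fun θ => h (circleMap 0 r θ) :=
    hcont.comp_continuous (continuous_circleMap 0 r) fun θ => by
      rw [mem_ball_zero_iff, hn]; exact hr
  have hwb : ∀ θ, ‖h (circleMap 0 r θ)‖ ≤ ∑' n, r ^ n * ‖c n‖ := fun θ => by
    rw [← (hh' _ (hn θ)).tsum_eq]
    refine tsum_of_norm_bounded hc.hasSum fun n => ?_
    rw [norm_smul, norm_pow, hn]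
  -- Only the second slot of ⟪h, h⟫ is expanded here. Each resulting integral is found by expanding
  -- h against the fixed n-th term, where orthogonality leaves m = n, and then conjugating to
  -- exchange the slots.
  have h1 := hasSum_integral_inner_circleMap hr0 hc hh' hwc hwb
  have hterm : ∀ n, ∫ θ in (0 : ℝ)..2 * Real.pi,
      ⟪h (circleMap 0 r θ), (circleMap 0 r θ) ^ n • c n⟫_ℂ =
        ((2 * Real.pi * ((r ^ n) ^ 2 * ‖c n‖ ^ 2) : ℝ) : ℂ) := fun n => by
    have h2 := hasSum_integral_inner_circleMap hr0 hc hh'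
      (w := fun θ => (circleMap 0 r θ) ^ n • c n) (B := r ^ n * ‖c n‖)
      (by have := continuous_circleMap 0 r; fun_prop)
      (fun θ => by rw [norm_smul, norm_pow, hn])
    have h3 : ∀ m, ∫ θ in (0 : ℝ)..2 * Real.pi,
        ⟪(circleMap 0 r θ) ^ n • c n, (circleMap 0 r θ) ^ m • c m⟫_ℂ =
          if m = n then ((2 * Real.pi * ((r ^ n) ^ 2 * ‖c n‖ ^ 2) : ℝ) : ℂ) else 0 := fun m => by
      simp only [inner_smul_left, inner_smul_right, map_pow]
      simp only [← mul_assoc]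
      rw [intervalIntegral.integral_mul_const]
      have := integral_circleMap_conj_pow_mul_pow r n m
      simp only [mul_comm ((starRingEnd ℂ (circleMap 0 r _)) ^ n)] at this ⊢
      rw [this]
      split_ifs with hmn
      · subst hmn
        rw [inner_self_eq_norm_sq_to_K]
        change _ * ((‖c m‖ : ℝ) : ℂ) ^ 2 = _
        push_cast
        ring
      · simp
    simp only [h3] at h2
    have h4 := h2.unique (hasSum_ite_eq n _)
    have h5 := congrArg (starRingEnd ℂ) h4
    rw [Complex.conj_ofReal] at h5
    rw [← h5]
    simp only [intervalIntegral.intervalIntegral_eq_integral_uIoc, Complex.real_smul, map_mul,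
      Complex.conj_ofReal, ← integral_conj, inner_conj_symm]
  simp only [hterm, inner_self_eq_norm_sq_to_K] at h1
  have h6 := Complex.hasSum_re h1
  simp only [Complex.ofReal_re] at h6
  convert h6
  rw [← Complex.ofReal_re (∫ θ in (0 : ℝ)..2 * Real.pi, ‖h (circleMap 0 r θ)‖ ^ 2),
    ← intervalIntegral.integral_ofReal]
  simp

end Parseval

/-! ### Bounded analytic functions as multipliers -/

namespace HardySpace

variable {E : Type*} [NormedAddCommGroup E] [InnerProductSpace ℂ E] [CompleteSpace E]

/-- A uniform bound on the `r`-weighted sums of squares for `0 ≤ r < 1` passes to `r = 1`. -/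
theorem sum_norm_sq_le {F : Type*} [NormedAddCommGroup F] {c : ℕ → F} {C : ℝ}
    (h : ∀ r : ℝ, 0 ≤ r → r < 1 → ∀ N : ℕ,
      ∑ n ∈ Finset.range N, (r ^ n) ^ 2 * ‖c n‖ ^ 2 ≤ C) (N : ℕ) :
    ∑ n ∈ Finset.range N, ‖c n‖ ^ 2 ≤ C := by
  have hcont : Continuous fun r : ℝ => ∑ n ∈ Finset.range N, (r ^ n) ^ 2 * ‖c n‖ ^ 2 := by
    fun_prop
  have ht := (hcont.tendsto 1).mono_left (nhdsWithin_le_nhds (s := Set.Iio 1))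
  simp only [one_pow, one_mul] at ht
  refine le_of_tendsto ht ?_
  filter_upwards [self_mem_nhdsWithin, nhdsWithin_le_nhds (lt_mem_nhds zero_lt_one)] with r hr hr0
  exact h r (le_of_lt hr0) hr N

/-- A bounded analytic operator-valued function maps `H²` into `H²` by pointwise multiplication. -/
theorem exists_coeffs_mul {Ψ : ℂ → E →L[ℂ] E} (hΨ : AnalyticOnNhd ℂ Ψ (Metric.ball 0 1)) {C : ℝ}
    (hC : ∀ z ∈ Metric.ball (0 : ℂ) 1, ‖Ψ z‖ ≤ C) (f : HardySpace E) :
    ∃ a : CoeffSpace E, (∀ z : OpenDisc, HasSum (fun n => (z : ℂ) ^ n • a n) (Ψ z (f z))) ∧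
      ‖a‖ ≤ C * ‖f‖ := by
  have hC0 : 0 ≤ C := (norm_nonneg _).trans (hC 0 (Metric.mem_ball_self one_pos))
  set F : ℂ → E := fun z => ∑' n, z ^ n • coeffs E f n with hF
  have hFa : AnalyticOnNhd ℂ F (Metric.ball 0 1) := analyticOnNhd_tsum_pow_smul (norm_coeffs_le f)
  have hFs : ∀ z : ℂ, ‖z‖ < 1 → HasSum (fun n => z ^ n • coeffs E f n) (F z) := fun z hz =>
    (summable_pow_smul_of_bounded (norm_coeffs_le f) hz).hasSum
  have hFf : ∀ z : OpenDisc, F z = f z := fun z => (f.hasSum_apply z).tsum_eq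
  set G : ℂ → E := fun z => Ψ z (F z) with hG
  have hGd : DifferentiableOn ℂ G (Metric.ball 0 1) :=
    hΨ.differentiableOn.clm_apply hFa.differentiableOn
  set c : ℕ → E := fun n => ((n.factorial : ℂ))⁻¹ • iteratedDeriv n G 0 with hc
  have hGs : ∀ z : ℂ, ‖z‖ < 1 → HasSum (fun n => z ^ n • c n) (G z) := fun z hz => by
    have := Complex.hasSum_taylorSeries_on_ball hGd (mem_ball_zero_iff.2 hz)
    simpa only [sub_zero, hc, smul_comm (z ^ _)] using this
  have hn : ∀ (r : ℝ), 0 ≤ r → ∀ θ, ‖circleMap 0 r θ‖ = r := fun r hr θ => by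
    simp [abs_of_nonneg hr]
  have hbound : ∀ N, ∑ n ∈ Finset.range N, ‖c n‖ ^ 2 ≤ (C * ‖f‖) ^ 2 := by
    -- Parseval at radius r < 1 turns the pointwise bound ‖G‖ ≤ C‖F‖ on the circle into a bound on
    -- coefficients, uniform in r; no boundary values are needed.
    refine sum_norm_sq_le fun r hr0 hr N => ?_
    have h1 := hasSum_norm_sq_of_hasSum_pow_smul hGs hGd.continuousOn hr0 hr
    have h2 := hasSum_norm_sq_of_hasSum_pow_smul hFs hFa.continuousOn hr0 hr
    have hcirc : ∀ {K : ℂ → E}, ContinuousOn K (Metric.ball 0 1) →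
        Continuous fun θ => K (circleMap 0 r θ) := fun hK =>
      hK.comp_continuous (continuous_circleMap 0 r) fun θ => by
        rw [mem_ball_zero_iff, hn r hr0]; exact hr
    have h3 : ∫ θ in (0 : ℝ)..2 * Real.pi, ‖G (circleMap 0 r θ)‖ ^ 2 ≤
        ∫ θ in (0 : ℝ)..2 * Real.pi, C ^ 2 * ‖F (circleMap 0 r θ)‖ ^ 2 := by
      refine intervalIntegral.integral_mono_on Real.two_pi_pos.le
        (Continuous.intervalIntegrable ?_ _ _) (Continuous.intervalIntegrable ?_ _ _) fun θ _ => ?_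
      · exact (hcirc hGd.continuousOn).norm.pow 2
      · exact continuous_const.mul ((hcirc hFa.continuousOn).norm.pow 2)
      rw [← mul_pow]
      have hz : circleMap 0 r θ ∈ Metric.ball (0 : ℂ) 1 := by
        rw [mem_ball_zero_iff, hn r hr0]; exact hr
      exact pow_le_pow_left₀ (norm_nonneg _) ((Ψ _).le_of_opNorm_le (hC _ hz) _) 2
    rw [intervalIntegral.integral_const_mul] at h3
    have h4 : ∫ θ in (0 : ℝ)..2 * Real.pi, ‖F (circleMap 0 r θ)‖ ^ 2 ≤ 2 * Real.pi * ‖f‖ ^ 2 := by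
      refine hasSum_le (fun n => ?_) h2 (by
        rw [norm_sq_eq]
        exact ((coeffs E f).summable_sq.hasSum.mul_left (2 * Real.pi)))
      have : (r ^ n) ^ 2 ≤ 1 := pow_le_one₀ (by positivity) (pow_le_one₀ hr0 hr.le)
      have := mul_le_mul_of_nonneg_right this (sq_nonneg ‖coeffs E f n‖)
      rw [one_mul] at this
      exact mul_le_mul_of_nonneg_left this Real.two_pi_pos.le
    have h5 := sum_le_hasSum (Finset.range N) (fun n _ => by positivity) h1
    rw [← Finset.mul_sum] at h5
    refine le_of_mul_le_mul_left ?_ Real.two_pi_pos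
    calc _ ≤ _ := h5.trans h3
      _ ≤ C ^ 2 * (2 * Real.pi * ‖f‖ ^ 2) := by gcongr
      _ = _ := by ring
  have hsum : Summable fun n => ‖c n‖ ^ 2 :=
    summable_of_sum_range_le (fun n => sq_nonneg _) hbound
  let a : CoeffSpace E := ⟨c, memℓp_gen (by simpa using hsum)⟩
  refine ⟨a, fun z => ?_, ?_⟩
  · have := hGs z (mem_ball_zero_iff.1 z.2)
    simpa only [hG, hFf z] using this
  · rw [← sq_le_sq₀ (norm_nonneg _) (by positivity), CoeffSpace.norm_sq_eq]
    exact Real.tsum_le_of_sum_range_le (fun n => sq_nonneg _) hbound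

/-- Bounded analytic operator-valued functions are multipliers of `H²`. -/
theorem exists_multiplication {Ψ : ℂ → E →L[ℂ] E} (hΨ : IsBoundedAnalytic Ψ) :
    ∃ M : HardySpace E →L[ℂ] HardySpace E, ∀ f z, M f z = Ψ z (f z) := by
  obtain ⟨ha, C, hC⟩ := hΨ
  choose a ha' hle using exists_coeffs_mul ha hC
  refine ⟨LinearMap.mkContinuous
    { toFun := fun f => ofHasSum (fun z : OpenDisc => Ψ z (f z)) (a f) (ha' f)
      map_add' := fun f g => HardySpace.ext fun z => map_add (Ψ z) (f z) (g z)
      map_smul' := fun c f => HardySpace.ext fun z => map_smul (Ψ z) c (f z) } C fun f => ?_,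
    fun f z => rfl⟩
  change ‖ofHasSum (fun z : OpenDisc => Ψ z (f z)) (a f) (ha' f)‖ ≤ _
  rw [norm_def, coeffs_ofHasSum]
  exact hle f

end HardySpace

/-! ### Block operators, power boundedness and renorming -/

section Block

theorem norm_sq_toLp_prod {H : Type*} [NormedAddCommGroup H] (f g : H) :
    ‖WithLp.toLp 2 (f, g)‖ ^ 2 = ‖f‖ ^ 2 + ‖g‖ ^ 2 :=
  WithLp.prod_norm_sq_eq_of_L2 _

variable {H : Type*} [NormedAddCommGroup H] [InnerProductSpace ℂ H]

theorem upperBlock_mul (Y X Z Y' X' Z' : H →L[ℂ] H) :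
    upperBlock Y X Z * upperBlock Y' X' Z' = upperBlock (Y * Y') (Y * X' + X * Z') (Z * Z') := by
  ext x
  obtain ⟨f, g⟩ := x
  simp [mul_apply_eq_comp, upperBlock_apply, add_assoc]

theorem upperBlock_one : upperBlock (1 : H →L[ℂ] H) 0 1 = 1 := by
  ext x
  obtain ⟨f, g⟩ := x
  simp [upperBlock_apply]

/-- The invertible block operator `[[1, Z], [0, R]]`. -/
def unitUpperBlock (Z : H →L[ℂ] H) (R : (H →L[ℂ] H)ˣ) :
    (WithLp 2 (H × H) →L[ℂ] WithLp 2 (H × H))ˣ where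
  val := upperBlock 1 Z R
  inv := upperBlock 1 (-(Z * (R⁻¹ : (H →L[ℂ] H)ˣ))) (R⁻¹ : (H →L[ℂ] H)ˣ)
  val_inv := by simp [upperBlock_mul, upperBlock_one]
  inv_val := by simp [upperBlock_mul, upperBlock_one, mul_assoc]

/-- Being a contraction in the equivalent norm ‖W ·‖ suffices; the similarity is V = W⁻¹. -/
theorem similarToContraction_of_norm_le {T : H →L[ℂ] H} (W : (H →L[ℂ] H)ˣ)
    (h : ∀ x, ‖(W : H →L[ℂ] H) (T x)‖ ≤ ‖(W : H →L[ℂ] H) x‖) : SimilarToContraction T := by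
  refine ⟨W⁻¹, ContinuousLinearMap.opNorm_le_bound _ zero_le_one fun x => ?_⟩
  have hx : (W : H →L[ℂ] H) (((W⁻¹ : (H →L[ℂ] H)ˣ) : H →L[ℂ] H) x) = x := by
    rw [← mul_apply_eq_comp, W.mul_inv, one_apply_eq_self]
  have := h (((W⁻¹ : (H →L[ℂ] H)ˣ) : H →L[ℂ] H) x)
  rw [hx] at this
  simpa using this

/-- An operator similar to a contraction is power bounded. -/
theorem SimilarToContraction.exists_norm_pow_le {T : H →L[ℂ] H} (h : SimilarToContraction T) :
    ∃ K : ℝ, 0 ≤ K ∧ ∀ n : ℕ, ‖T ^ n‖ ≤ K := by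
  obtain ⟨V, hV⟩ := h
  refine ⟨‖(V : H →L[ℂ] H)‖ * ‖((V⁻¹ : (H →L[ℂ] H)ˣ) : H →L[ℂ] H)‖, by positivity, fun n => ?_⟩
  set C : H →L[ℂ] H := ((V⁻¹ : (H →L[ℂ] H)ˣ) : H →L[ℂ] H) * T * V with hC
  have hC1 : ‖C‖ ≤ 1 := hV
  have hCn : ‖C ^ n‖ ≤ 1 := by
    induction n with
    | zero => exact ContinuousLinearMap.norm_id_le
    | succ n ih =>
      rw [pow_succ]
      exact (norm_mul_le _ _).trans (mul_le_one₀ ih (norm_nonneg _) hC1)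
  have hT : T = V * C * ((V⁻¹ : (H →L[ℂ] H)ˣ) : H →L[ℂ] H) := by
    simp [hC, mul_assoc]
  rw [hT, Units.conj_pow]
  refine (norm_mul_le _ _).trans (mul_le_mul_of_nonneg_right ?_ (norm_nonneg _))
  exact (norm_mul_le _ _).trans (mul_le_of_le_one_right (norm_nonneg _) hCn)

/-- The upper right corner of the `n`-th power of `[[Y, X], [0, Z]]`. -/
def cornerPow (Y X Z : H →L[ℂ] H) : ℕ → (H →L[ℂ] H)
  | 0 => 0
  | n + 1 => Y * cornerPow Y X Z n + X * Z ^ n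

theorem upperBlock_pow (Y X Z : H →L[ℂ] H) (n : ℕ) :
    upperBlock Y X Z ^ n = upperBlock (Y ^ n) (cornerPow Y X Z n) (Z ^ n) := by
  induction n with
  | zero => simp [cornerPow, upperBlock_one]
  | succ n ih => rw [pow_succ', ih, upperBlock_mul, cornerPow, pow_succ', pow_succ']

theorem norm_cornerPow_apply_le (Y X Z : H →L[ℂ] H) (n : ℕ) (g : H) :
    ‖cornerPow Y X Z n g‖ ≤ ‖upperBlock Y X Z ^ n‖ * ‖g‖ := by
  have h := (upperBlock Y X Z ^ n).le_opNorm (WithLp.toLp 2 (0, g))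
  have h0 : ‖WithLp.toLp 2 ((0 : H), g)‖ = ‖g‖ := by
    rw [← sq_eq_sq₀ (norm_nonneg _) (norm_nonneg _), norm_sq_toLp_prod]; simp
  rw [h0] at h
  refine le_trans ?_ h
  rw [upperBlock_pow, upperBlock_apply, ← sq_le_sq₀ (norm_nonneg _) (norm_nonneg _),
    norm_sq_toLp_prod]
  simp only [map_zero, zero_add]
  exact le_add_of_nonneg_right (sq_nonneg _)

/-- The blocks with corners X and X' are conjugate by [[1, Q], [0, 1]], so the commutator
contributions telescope in each power. -/
theorem cornerPow_eq_add {Y X Z X' Q : H →L[ℂ] H} (h : X = Y * Q - Q * Z + X') (n : ℕ) :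
    cornerPow Y X Z n = Y ^ n * Q - Q * Z ^ n + cornerPow Y X' Z n := by
  induction n with
  | zero => simp [cornerPow]
  | succ n ih =>
    rw [cornerPow, ih, cornerPow, pow_succ' Y, pow_succ' Z, h]
    noncomm_ring

variable [CompleteSpace H]

/-- The invertible square root of `1 + B* B`. -/
theorem exists_unit_norm_sq_eq (B : H →L[ℂ] H) :
    ∃ R : (H →L[ℂ] H)ˣ, ∀ g, ‖(R : H →L[ℂ] H) g‖ ^ 2 = ‖g‖ ^ 2 + ‖B g‖ ^ 2 := by
  set G : H →L[ℂ] H := 1 + star B * B with hG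
  have h1 : (1 : H →L[ℂ] H) ≤ G := le_add_of_nonneg_right (star_mul_self_nonneg B)
  have h0 : 0 ≤ G := zero_le_one.trans h1
  have hu : IsUnit G := CStarAlgebra.isUnit_of_le 1 h1
  obtain ⟨R, hR⟩ := (CFC.isUnit_sqrt_iff G h0).2 hu
  refine ⟨R, fun g => ?_⟩
  have hsa : ContinuousLinearMap.adjoint (CFC.sqrt G) = CFC.sqrt G :=
    (CFC.sqrt_nonneg G).isSelfAdjoint.star_eq
  have h2 : ⟪CFC.sqrt G g, CFC.sqrt G g⟫_ℂ = ⟪G g, g⟫_ℂ := by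
    rw [← ContinuousLinearMap.adjoint_inner_left, hsa, ← mul_apply_eq_comp,
      CFC.sqrt_mul_sqrt_self G h0]
  have h3 : ⟪G g, g⟫_ℂ = ⟪g, g⟫_ℂ + ⟪B g, B g⟫_ℂ := by
    rw [← ContinuousLinearMap.adjoint_inner_left, ← inner_add_left]
    rfl
  rw [hR]
  have h4 := congrArg RCLike.re (h2.trans h3)
  rw [map_add] at h4
  simpa only [inner_self_eq_norm_sq] using h4

end Block

/-! ### From a multiplier to a contraction -/

namespace HardySpace

variable {E : Type*} [NormedAddCommGroup E] [InnerProductSpace ℂ E] [CompleteSpace E]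

local notation "L" => ContinuousLinearMap.adjoint (shift E)

/-- Substitute A = PA + S(S*A) in the first term only. With Q = S*A, this shows that X is PA up to
the commutator SQ - QS*. -/
theorem eq_shift_mul_sub_mul_adjoint_add {X A : HardySpace E →L[ℂ] HardySpace E}
    (hX : X = A - L ∘L A ∘L L) :
    X = shift E * (L * A) - (L * A) * L + projConst E * A := by
  ext1 g
  have h := projConst_add_shift_adjoint_shift (A g)
  rw [hX]
  change A g - L (A (L g)) = shift E (L (A g)) - L (A (L g)) + projConst E (A g)
  conv_lhs => rw [← h]
  abel

theorem similarToContraction_of_multiplier {X A : HardySpace E →L[ℂ] HardySpace E}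
    {Ψ : ℂ → E →L[ℂ] E} (hΨ : IsBoundedAnalytic Ψ)
    (hA : ∀ (f : HardySpace E) (z : OpenDisc),
      (ContinuousLinearMap.adjoint A ∘L projConst E) f z = Ψ z (projConst E f z))
    (hX : X = A - L ∘L A ∘L L) :
    SimilarToContraction (upperBlock (shift E) X L) := by
  obtain ⟨M, hM⟩ := exists_multiplication hΨ
  set B := ContinuousLinearMap.adjoint M with hB
  have hMS : M ∘L shift E = shift E ∘L M := by
    ext f z
    simp [hM, shift_apply]
  have hBL : B ∘L L = L ∘L B := by
    rw [hB, ← ContinuousLinearMap.adjoint_comp, ← ContinuousLinearMap.adjoint_comp, hMS]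
  have hMP : ContinuousLinearMap.adjoint A ∘L projConst E = M ∘L projConst E := by
    ext f z
    rw [hA, ContinuousLinearMap.comp_apply, hM]
  have hPB : projConst E ∘L A = projConst E ∘L B := by
    have := congrArg ContinuousLinearMap.adjoint hMP
    simpa only [ContinuousLinearMap.adjoint_comp, ContinuousLinearMap.adjoint_adjoint,
      adjoint_projConst] using this
  obtain ⟨R, hR⟩ := exists_unit_norm_sq_eq B
  -- The entry S*A removes the commutator part of X; R gives the second summand the norm ‖g‖² +
  -- ‖Bg‖².
  refine similarToContraction_of_norm_le (unitUpperBlock (L ∘L A) R) ?_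
  rintro ⟨f, g⟩
  change ‖upperBlock 1 (L ∘L A) R (upperBlock (shift E) X L (WithLp.toLp 2 (f, g)))‖ ≤
    ‖upperBlock 1 (L ∘L A) R (WithLp.toLp 2 (f, g))‖
  rw [← sq_le_sq₀ (norm_nonneg _) (norm_nonneg _)]
  simp only [upperBlock_apply, norm_sq_toLp_prod, one_apply_eq_self, hR]
  have hXg : X g = shift E (L (A g)) - L (A (L g)) + projConst E (A g) :=
    DFunLike.congr_fun (eq_shift_mul_sub_mul_adjoint_add hX) g
  have hcorner : shift E f + X g + (L ∘L A) (L g) =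
      shift E (f + L (A g)) + projConst E (B g) := by
    have : projConst E (A g) = projConst E (B g) := DFunLike.congr_fun hPB g
    rw [hXg, this, map_add]
    simp only [ContinuousLinearMap.comp_apply]
    abel
  have hBg : B (L g) = L (B g) := DFunLike.congr_fun hBL g
  rw [hcorner, norm_sq_shift_add_projConst, hBg, ContinuousLinearMap.comp_apply]
  have h1 := norm_sq_projConst_add_norm_sq_adjoint_shift (B g)
  have h2 := norm_sq_projConst_add_norm_sq_adjoint_shift g
  -- The terms in B cancel exactly by `h1`; the slack in the inequality is ‖Pg‖².
  nlinarith [sq_nonneg ‖projConst E g‖]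

end HardySpace

/-! ### From power boundedness to a multiplier -/

namespace HardySpace

variable {E : Type*} [NormedAddCommGroup E] [InnerProductSpace ℂ E] [CompleteSpace E]

local notation "L" => ContinuousLinearMap.adjoint (shift E)

/-- The partial sums of the series `∑ⱼ S*ʲ X S*ʲ`. -/
def steinSum (X : HardySpace E →L[ℂ] HardySpace E) (n : ℕ) : HardySpace E →L[ℂ] HardySpace E :=
  ∑ j ∈ Finset.range n, L ^ j * X * L ^ j

theorem steinSum_succ (X : HardySpace E →L[ℂ] HardySpace E) (n : ℕ) :
    steinSum X (n + 1) = X + L * steinSum X n * L := by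
  rw [steinSum, Finset.sum_range_succ', steinSum, Finset.mul_sum, Finset.sum_mul, add_comm]
  refine congrArg₂ (· + ·) (by simp) (Finset.sum_congr rfl fun j _ => ?_)
  nth_rw 1 [pow_succ' L]
  rw [pow_succ L]
  simp only [mul_assoc]

theorem steinSum_add (X : HardySpace E →L[ℂ] HardySpace E) (n m : ℕ) :
    steinSum X (n + m) = steinSum X n + L ^ n * steinSum X m * L ^ n := by
  rw [steinSum, Finset.sum_range_add, steinSum, steinSum, Finset.mul_sum, Finset.sum_mul]
  congr 1
  refine Finset.sum_congr rfl fun j _ => ?_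
  nth_rw 1 [pow_add L]
  rw [add_comm n j, pow_add]
  simp only [mul_assoc]

/-- The corner is ∑ⱼ Sⁿ⁻ʲXS*ʲ over j ≤ n, and S*S = 1 collapses S*ⁿSⁿ⁻ʲ to S*ʲ. Bounds on the
corners thus pass to the partial sums. -/
theorem adjoint_shift_pow_mul_cornerPow (X : HardySpace E →L[ℂ] HardySpace E) (n : ℕ) :
    L ^ n * cornerPow (shift E) X L (n + 1) = steinSum X (n + 1) := by
  induction n with
  | zero => simp [cornerPow, steinSum]
  | succ n ih =>
    have hLS : L * shift E = 1 := by
      ext1 f; exact adjoint_shift_shift f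
    rw [cornerPow, mul_add, steinSum, Finset.sum_range_succ, ← steinSum, ← ih, pow_succ L n,
      ← mul_assoc, mul_assoc (L ^ n), hLS, mul_one, mul_assoc (L ^ n * L)]

/-- If `[[S, X], [0, S*]]` is power bounded, then `A - S* A S* = X` has a bounded solution. -/
theorem exists_stein_solution {X : HardySpace E →L[ℂ] HardySpace E} {K : ℝ} (hK0 : 0 ≤ K)
    (hK : ∀ n g, ‖cornerPow (shift E) X L n g‖ ≤ K * ‖g‖) :
    ∃ A : HardySpace E →L[ℂ] HardySpace E, X = A - L ∘L A ∘L L := by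
  have hbound : ∀ n g, ‖steinSum X n g‖ ≤ K * ‖g‖ := fun n g => by
    cases n with
    | zero => simpa [steinSum] using by positivity
    | succ n =>
      rw [← adjoint_shift_pow_mul_cornerPow, mul_apply_eq_comp]
      exact (norm_adjoint_shift_pow_apply_le _ _).trans (hK _ _)
  -- A block of the series starting at n is S*ⁿ(partial sum)S*ⁿg, of norm at most K‖S*ⁿg‖, which
  -- tends to 0.
  have hcauchy : ∀ g, CauchySeq fun n => steinSum X n g := fun g => by
    refine cauchySeq_of_le_tendsto_0' (fun n => K * ‖(L ^ n) g‖) (fun n m hnm => ?_) (by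
      simpa using (tendsto_adjoint_shift_pow g).const_mul K)
    obtain ⟨k, rfl⟩ := Nat.exists_eq_add_of_le hnm
    rw [dist_comm, dist_eq_norm, steinSum_add, _root_.add_apply, add_sub_cancel_left,
      mul_apply_eq_comp, mul_apply_eq_comp]
    exact (norm_adjoint_shift_pow_apply_le _ _).trans (hbound _ _)
  choose A hA using fun g => cauchySeq_tendsto_of_complete (hcauchy g)
  refine ⟨continuousLinearMapOfTendsto (steinSum X) (tendsto_pi_nhds.2 hA), ?_⟩
  ext1 g
  change X g = A g - L (A (L g))
  rw [eq_sub_iff_add_eq]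
  refine tendsto_nhds_unique ?_ ((Filter.tendsto_add_atTop_iff_nat 1).2 (hA g))
  simp only [steinSum_succ]
  exact tendsto_const_nhds.add (((L).continuous.tendsto _).comp (hA (L g)))

/-- Each recursion step shifts the old vector isometrically off the constants and adds a constant,
so the norms add in squares. -/
theorem norm_sq_cornerPow_shift (A : HardySpace E →L[ℂ] HardySpace E) (n : ℕ) (g : HardySpace E) :
    ‖cornerPow (shift E) (projConst E * A) L n g‖ ^ 2 =
      ∑ k ∈ Finset.range n, ‖projConst E (A ((L ^ k) g))‖ ^ 2 := by
  induction n with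
  | zero => simp [cornerPow]
  | succ n ih =>
    rw [Finset.sum_range_succ, ← ih, ← norm_sq_shift_add_projConst]
    rfl

/-- On a kernel, S*ᵏ acts as the scalar z̄ᵏ, so the square sum in `norm_sq_cornerPow_shift` tends to
∑ |z|²ᵏ times ‖PA(kernel)‖². The same factor ∑ |z|²ᵏ occurs in the squared norm of the kernel and
cancels. -/
theorem norm_projConst_apply_kernel_le {A : HardySpace E →L[ℂ] HardySpace E} {C : ℝ} (hC0 : 0 ≤ C)
    (hC : ∀ n g, ‖cornerPow (shift E) (projConst E * A) L n g‖ ≤ C * ‖g‖)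
    (z : OpenDisc) (x : E) : ‖projConst E (A (kernel z x))‖ ≤ C * ‖x‖ := by
  have hz : ‖(z : ℂ)‖ < 1 := mem_ball_zero_iff.1 z.2
  have hs : Summable fun n : ℕ => (‖(z : ℂ)‖ ^ 2) ^ n :=
    summable_geometric_of_lt_one (by positivity) (pow_lt_one₀ (norm_nonneg _) hz two_ne_zero)
  have hpos : 0 < ∑' n : ℕ, (‖(z : ℂ)‖ ^ 2) ^ n :=
    hs.tsum_pos (fun n => by positivity) 0 (by simp)
  have hle : (∑' n : ℕ, (‖(z : ℂ)‖ ^ 2) ^ n) * ‖projConst E (A (kernel z x))‖ ^ 2 ≤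
      (C * ‖kernel z x‖) ^ 2 := by
    rw [← tsum_mul_right]
    refine Real.tsum_le_of_sum_range_le (fun n => by positivity) fun n => ?_
    have h := pow_le_pow_left₀ (norm_nonneg _) (hC n (kernel z x)) 2
    rw [norm_sq_cornerPow_shift] at h
    refine le_of_eq_of_le (Finset.sum_congr rfl fun k _ => ?_) h
    rw [adjoint_shift_pow_kernel, map_smul, map_smul, norm_smul, norm_pow, RCLike.norm_conj]
    ring
  rw [mul_pow, norm_sq_kernel, mul_left_comm, ← mul_pow] at hle
  exact (sq_le_sq₀ (norm_nonneg _) (by positivity)).1 (le_of_mul_le_mul_left hle hpos)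

/-- Dual to the bound on kernels: pairing (A*e)(z) with y equals pairing e with the constant term of
A applied to the kernel at z and y. The choice y = (A*e)(z) gives the norm. -/
theorem norm_adjoint_monomial_apply_le {A : HardySpace E →L[ℂ] HardySpace E} {C : ℝ} (hC0 : 0 ≤ C)
    (hC : ∀ n g, ‖cornerPow (shift E) (projConst E * A) L n g‖ ≤ C * ‖g‖)
    (e : E) (z : OpenDisc) :
    ‖(ContinuousLinearMap.adjoint A (monomial 0 e)) z‖ ≤ C * ‖e‖ := by
  set y := (ContinuousLinearMap.adjoint A (monomial 0 e)) z with hy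
  have h1 : ⟪y, y⟫_ℂ = ⟪coeffs E (A (kernel z y)) 0, e⟫_ℂ := by
    conv_lhs => rw [hy, ← inner_kernel_left, ContinuousLinearMap.adjoint_inner_right]
    rw [← inner_conj_symm, inner_monomial_left, inner_conj_symm]
  have h2 : ‖y‖ * ‖y‖ ≤ ‖y‖ * (C * ‖e‖) := by
    rw [← inner_self_eq_norm_mul_norm (𝕜 := ℂ), inner_self_re_eq_norm, h1]
    refine (norm_inner_le_norm _ _).trans ?_
    rw [← norm_projConst_apply]
    have := mul_le_mul_of_nonneg_right (norm_projConst_apply_kernel_le hC0 hC z y) (norm_nonneg e)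
    linarith
  rcases (norm_nonneg y).eq_or_lt with h | h
  · rw [← h]; positivity
  · exact le_of_mul_le_mul_left h2 h

/-- The `n`-th Taylor coefficient of `z ↦ (e ↦ (M e)(z))`. -/
def symbolCoeff (M : HardySpace E →L[ℂ] HardySpace E) (n : ℕ) : E →L[ℂ] E :=
  LinearMap.mkContinuous
    { toFun := fun e => coeffs E (M (monomial 0 e)) n
      map_add' := fun x y => by
        have : monomial 0 (x + y) = monomial 0 x + monomial 0 y := by
          ext z; simp [monomial_zero_apply]
        rw [this, map_add, coeffs_add_apply]
      map_smul' := fun c x => by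
        have : monomial 0 (c • x) = c • monomial 0 x := by
          ext z; simp [monomial_zero_apply]
        rw [this, map_smul, coeffs_smul_apply, RingHom.id_apply] } ‖M‖ fun e => by
    refine (norm_coeffs_le _ n).trans ((M.le_opNorm _).trans ?_)
    rw [norm_monomial]

theorem norm_symbolCoeff_le (M : HardySpace E →L[ℂ] HardySpace E) (n : ℕ) :
    ‖symbolCoeff M n‖ ≤ ‖M‖ := LinearMap.mkContinuous_norm_le _ (norm_nonneg _) _

/-- If the functions `M e` are uniformly bounded by a multiple of `‖e‖`, then they are given by a
bounded analytic symbol. -/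
theorem exists_symbol {M : HardySpace E →L[ℂ] HardySpace E} {C : ℝ} (hC0 : 0 ≤ C)
    (hC : ∀ (e : E) (z : OpenDisc), ‖M (monomial 0 e) z‖ ≤ C * ‖e‖) :
    ∃ Ψ : ℂ → E →L[ℂ] E, IsBoundedAnalytic Ψ ∧
      ∀ (f : HardySpace E) (z : OpenDisc), (M ∘L projConst E) f z = Ψ z (projConst E f z) := by
  have happ : ∀ (z : OpenDisc) (e : E),
      (∑' n, (z : ℂ) ^ n • symbolCoeff M n) e = M (monomial 0 e) z := fun z e => by
    have h1 := (summable_pow_smul_of_bounded (norm_symbolCoeff_le M)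
      (mem_ball_zero_iff.1 z.2)).hasSum.mapL (ContinuousLinearMap.apply ℂ E e)
    exact h1.unique (hasSum_apply (M (monomial 0 e)) z)
  -- The coefficient bound ‖M‖ yields analyticity; boundedness on the whole disc comes from `hC`.
  refine ⟨fun z => ∑' n, z ^ n • symbolCoeff M n,
    ⟨analyticOnNhd_tsum_pow_smul (norm_symbolCoeff_le M), C, fun z hz => ?_⟩, fun f z => ?_⟩
  · refine ContinuousLinearMap.opNorm_le_bound _ hC0 fun e => ?_
    rw [happ ⟨z, hz⟩ e]
    exact hC e ⟨z, hz⟩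
  · rw [happ z, ContinuousLinearMap.comp_apply, projConst_apply_eq, monomial_zero_apply]

theorem exists_multiplier_of_similarToContraction {X : HardySpace E →L[ℂ] HardySpace E}
    (h : SimilarToContraction (upperBlock (shift E) X L)) :
    ∃ (A : HardySpace E →L[ℂ] HardySpace E) (Ψ : ℂ → E →L[ℂ] E), IsBoundedAnalytic Ψ ∧
      (∀ (f : HardySpace E) (z : OpenDisc),
        (ContinuousLinearMap.adjoint A ∘L projConst E) f z = Ψ z (projConst E f z)) ∧
      X = A - L ∘L A ∘L L := by
  obtain ⟨K, hK0, hK⟩ := h.exists_norm_pow_le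
  have hcorner : ∀ n g, ‖cornerPow (shift E) X L n g‖ ≤ K * ‖g‖ := fun n g =>
    (norm_cornerPow_apply_le _ _ _ n g).trans (mul_le_mul_of_nonneg_right (hK n) (norm_nonneg g))
  obtain ⟨A, hA⟩ := exists_stein_solution hK0 hcorner
  -- Removing the commutator SQ - QS* from the corner costs at most 2‖Q‖ in every power, since S and
  -- S* are contractions.
  set Q := L * A with hQ
  have hcorner' : ∀ n g, ‖cornerPow (shift E) (projConst E * A) L n g‖ ≤
      (K + ‖Q‖ + ‖Q‖) * ‖g‖ := fun n g => by
    have h1 := DFunLike.congr_fun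
      (cornerPow_eq_add (eq_shift_mul_sub_mul_adjoint_add hA) n) g
    have h2 : cornerPow (shift E) (projConst E * A) L n g =
        cornerPow (shift E) X L n g - (shift E ^ n) (Q g) + Q ((L ^ n) g) := by
      rw [h1]
      change _ = (shift E ^ n) (Q g) - Q ((L ^ n) g) + _ - _ + _
      abel
    rw [h2, add_mul, add_mul]
    refine (norm_add_le _ _).trans (add_le_add ((norm_sub_le _ _).trans
      (add_le_add (hcorner n g) ?_)) ?_)
    · rw [norm_shift_pow_apply]
      exact Q.le_opNorm g
    · exact (Q.le_opNorm _).trans (mul_le_mul_of_nonneg_left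
        (norm_adjoint_shift_pow_apply_le n g) (norm_nonneg _))
  have hC0 : 0 ≤ K + ‖Q‖ + ‖Q‖ := by positivity
  obtain ⟨Ψ, hΨ, hΨA⟩ := exists_symbol hC0 (norm_adjoint_monomial_apply_le hC0 hcorner')
  exact ⟨A, Ψ, hΨ, hΨA, hA⟩

/-- The equation is tested separately on constants, where S* vanishes, and on the range of S, where
S*S = 1; these two subspaces span H². -/
theorem eq_sub_adjoint_shift_comp_iff (X A : HardySpace E →L[ℂ] HardySpace E) :
    X = A - L ∘L A ∘L L ↔
      A ∘L projConst E = X ∘L projConst E ∧ X ∘L shift E = A ∘L shift E - L ∘L A := by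
  constructor
  · rintro rfl
    constructor <;> ext1 f <;> simp
  · rintro ⟨h1, h2⟩
    ext1 f
    have h3 : A (projConst E f) = X (projConst E f) := DFunLike.congr_fun h1 f
    have h4 : X (shift E (L f)) = A (shift E (L f)) - L (A (L f)) := DFunLike.congr_fun h2 (L f)
    change X f = A f - L (A (L f))
    conv_lhs => rw [← projConst_add_shift_adjoint_shift f, map_add, ← h3, h4]
    rw [← add_sub_assoc, ← map_add, projConst_add_shift_adjoint_shift]

end HardySpace

end

theorem theorem2p2 {E : Type*} [NormedAddCommGroup E] [InnerProductSpace ℂ E] [CompleteSpace E]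
    [TopologicalSpace.SeparableSpace E] (X : HardySpace E →L[ℂ] HardySpace E) :
    List.TFAE [
      SimilarToContraction
        (upperBlock (HardySpace.shift E) X (ContinuousLinearMap.adjoint (HardySpace.shift E))),
      ∃ (A : HardySpace E →L[ℂ] HardySpace E) (Ψ : ℂ → E →L[ℂ] E),
        IsBoundedAnalytic Ψ ∧
        (∀ (f : HardySpace E) (z : OpenDisc),
          (ContinuousLinearMap.adjoint A ∘L HardySpace.projConst E) f z =
            Ψ z (HardySpace.projConst E f z)) ∧
        X = A - ContinuousLinearMap.adjoint (HardySpace.shift E) ∘L A ∘L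
          ContinuousLinearMap.adjoint (HardySpace.shift E),
      ∃ (A : HardySpace E →L[ℂ] HardySpace E) (Ψ : ℂ → E →L[ℂ] E),
        IsBoundedAnalytic Ψ ∧
        A ∘L HardySpace.projConst E = X ∘L HardySpace.projConst E ∧
        (∀ (f : HardySpace E) (z : OpenDisc),
          (ContinuousLinearMap.adjoint A ∘L HardySpace.projConst E) f z =
            Ψ z (HardySpace.projConst E f z)) ∧
        X ∘L HardySpace.shift E =
          A ∘L HardySpace.shift E - ContinuousLinearMap.adjoint (HardySpace.shift E) ∘L A] := by
  tfae_have 1 → 2 := HardySpace.exists_multiplier_of_similarToContraction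
  tfae_have 2 → 1 := fun ⟨_, _, hΨ, hA, hX⟩ =>
    HardySpace.similarToContraction_of_multiplier hΨ hA hX
  tfae_have 2 ↔ 3 := by
    simp only [HardySpace.eq_sub_adjoint_shift_comp_iff]
    refine exists_congr fun A => exists_congr fun Ψ => ?_
    tauto
  tfae_finish
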